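/- Let $X$ be a complex Banach space and let $T\in L(X)$ be a bounded linear operator. For a bounded operator $S$ on a normed space $Y$ and $n\in\mathbb N=\{0,1,2,\dots\}$, let $S_{[n]}$ be the restriction of $S$ to the range $\mathcal R(S^n)$, so that its kernel is $\mathcal N(S_{[n]})=\mathcal N(S)\cap\mathcal R(S^n)$. The degree of stable iteration of $S$ is $$\mathrm{dis}(S)=\inf\{m\in\mathbb N:\ \mathcal N(S_{[m]})=\mathcal N(S_{[r]})\ \text{for all } r\ge m\}\in\mathbb N\cup\{\infty\},\qquad \inf\emptyset=\infty .$$ The operator $S$ is called semi-regular if $\mathcal R(S)$ is closed and $\mathrm{dis}(S)=0$, and nilpotent of degree $d\in\mathbb N$ if $d$ is the least $k\in\mathbb N$ with $S^k=0$ (the operator on the zero space is nilpotent of degree $0$). The operator $T$ is of Kato-type of degree $d$ if there are closed $T$-invariant subspaces $M,N$ of $X$ with $X=M\oplus N$ such that the restriction $T_M$ of $T$ to $M$ is semi-regular and the restriction $T_N$ of $T$ to $N$ is nilpotent of degree $d$; $T$ is of Kato-type if it is of Kato-type of some degree $d\in\mathbb N$. Theorem. If $T$ is of Kato-type, then its degree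 is $\mathrm{dis}(T)$; that is, for every $d\in\mathbb N$, $T$ is of Kato-type of degree $d$ if and only if $\mathrm{dis}(T)=d$. (In particular $\mathrm{dis}(T)<\infty$ and the degree is unique.) -/

import Mathlib

section KatoType

variable {X : Type*} [NormedAddCommGroup X] [NormedSpace ℂ X]

/-- The range `R(T ^ n)`, as a linear subspace of `X`. -/
def powRange (T : X →L[ℂ] X) (n : ℕ) : Submodule ℂ X :=
  LinearMap.range ((T ^ n : X →L[ℂ] X) : X →ₗ[ℂ] X)

theorem powRange_invariant (T : X →L[ℂ] X) (n : ℕ) :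
    ∀ x ∈ powRange T n, T x ∈ powRange T n := by
  rintro _ ⟨y, rfl⟩
  refine ⟨T y, ?_⟩
  change (T ^ n * T) y = (T * T ^ n) y
  rw [← pow_succ, ← pow_succ']

/-- The operator `T_[n]`: the restriction of `T` to the range `R(T ^ n)`. -/
def restrictPowRange (T : X →L[ℂ] X) (n : ℕ) : powRange T n →L[ℂ] powRange T n :=
  T.restrict (powRange_invariant T n)

/-- The kernel `N(T_[n])`, viewed as a linear subspace of `X`. -/
def kerPowRange (T : X →L[ℂ] X) (n : ℕ) : Submodule ℂ X :=
  (LinearMap.ker (restrictPowRange T n : powRange T n →ₗ[ℂ] powRange T n)).map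
    (powRange T n).subtype

/-- The set `Δ(T)` of all `m` such that `N(T_[m]) = N(T_[r])` for every `r ≥ m`. -/
def stableIterationSet (T : X →L[ℂ] X) : Set ℕ :=
  {m | ∀ r, m ≤ r → kerPowRange T m = kerPowRange T r}

/-- The degree of stable iteration `dis(T) = inf Δ(T)`, with `inf ∅ = ∞`. -/
noncomputable def dis (T : X →L[ℂ] X) : ℕ∞ :=
  ⨅ m ∈ stableIterationSet T, (m : ℕ∞)

/-- `T` is semi-regular: its range is closed and `dis(T) = 0`. -/
def IsSemiregular (T : X →L[ℂ] X) : Prop :=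
  IsClosed (Set.range T) ∧ dis T = 0

/-- `(M, N) ∈ Red(T)`: `M` and `N` are closed `T`-invariant subspaces and `X = M ⊕ N`. -/
structure IsReducedBy (T : X →L[ℂ] X) (M N : Submodule ℂ X) : Prop where
  isClosed_left : IsClosed (M : Set X)
  isClosed_right : IsClosed (N : Set X)
  invariant_left : ∀ x ∈ M, T x ∈ M
  invariant_right : ∀ x ∈ N, T x ∈ N
  isCompl : IsCompl M N

/-- `S` is nilpotent of degree `d`: `S` is nilpotent and `d` is the least `k` with `S ^ k = 0`
(so the operator on the zero space is nilpotent of degree `0`). -/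
def IsNilpotentOfDegree (S : X →L[ℂ] X) (d : ℕ) : Prop :=
  IsNilpotent S ∧ nilpotencyClass S = d

/-- `T` is of Kato-type of degree `d`: for some `(M, N) ∈ Red(T)`, the restriction of `T` to `M`
is semi-regular and the restriction of `T` to `N` is nilpotent of degree `d`. -/
def IsKatoTypeOfDegree (T : X →L[ℂ] X) (d : ℕ) : Prop :=
  ∃ (M N : Submodule ℂ X) (h : IsReducedBy T M N),
    IsSemiregular (T.restrict h.invariant_left) ∧
      IsNilpotentOfDegree (T.restrict h.invariant_right) d

/-- `T` is of Kato-type: it is of Kato-type of some degree. -/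
def IsKatoType (T : X →L[ℂ] X) : Prop :=
  ∃ d : ℕ, IsKatoTypeOfDegree T d

end KatoType

section KatoTypeDegree

variable {X : Type*} [NormedAddCommGroup X] [NormedSpace ℂ X]

/-! For `n ≥ d` the nilpotent summand dies, so R(T^n) ⊆ M; as dis(T_M) = 0, N(T) ∩ R(T^n) is then
N(T_M), independent of `n`. At `n = d - 1` the kernel also contains a nonzero vector of N. Hence
`stableIterationSet T` is exactly `Set.Ici d`. The converse is uniqueness: any Kato degree equals
dis(T). -/

theorem mem_powRange_iff {T : X →L[ℂ] X} {n : ℕ} {x : X} :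
    x ∈ powRange T n ↔ ∃ y, (T ^ n) y = x :=
  Iff.rfl

theorem mem_kerPowRange_iff {T : X →L[ℂ] X} {n : ℕ} {x : X} :
    x ∈ kerPowRange T n ↔ T x = 0 ∧ x ∈ powRange T n := by
  constructor
  · rintro ⟨y, hy, rfl⟩
    exact ⟨congrArg Subtype.val (LinearMap.mem_ker.1 hy), y.2⟩
  · rintro ⟨h0, hx⟩
    exact ⟨⟨x, hx⟩, LinearMap.mem_ker.2 (Subtype.ext h0), rfl⟩

theorem powRange_antitone (T : X →L[ℂ] X) : Antitone (powRange T) := by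
  rintro m n hmn _ ⟨y, rfl⟩
  refine ⟨(T ^ (n - m)) y, ?_⟩
  change (T ^ m * T ^ (n - m)) y = (T ^ n) y
  rw [← pow_add, Nat.add_sub_cancel' hmn]

theorem kerPowRange_antitone (T : X →L[ℂ] X) : Antitone (kerPowRange T) := by
  intro m n hmn x hx
  rw [mem_kerPowRange_iff] at hx ⊢
  exact ⟨hx.1, powRange_antitone T hmn hx.2⟩

theorem coe_restrict_pow_apply (T : X →L[ℂ] X) {M : Submodule ℂ X} (hM : ∀ x ∈ M, T x ∈ M)
    (n : ℕ) (x : M) : (((T.restrict hM) ^ n) x : X) = (T ^ n) x := by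
  induction n generalizing x with
  | zero => rfl
  | succ n ih =>
    rw [pow_succ, pow_succ]
    exact ih (T.restrict hM x)

theorem ker_le_powRange_of_dis_eq_zero {T : X →L[ℂ] X} (h : dis T = 0) {x : X} (hx : T x = 0)
    (n : ℕ) : x ∈ powRange T n := by
  have h0 : 0 ∈ stableIterationSet T := by
    by_contra hn
    -- An infimum of naturals omitting 0 is at least 1, also when the set is empty and the infimum
    -- is `⊤`.
    have : (1 : ℕ∞) ≤ dis T := by
      refine le_iInf₂ fun m hm => ?_
      have : m ≠ 0 := fun hm0 => hn (hm0 ▸ hm)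
      exact_mod_cast Nat.one_le_iff_ne_zero.2 this
    rw [h] at this
    exact absurd this (by simp)
  have hmem : x ∈ kerPowRange T 0 := mem_kerPowRange_iff.2 ⟨hx, x, rfl⟩
  rw [h0 n n.zero_le] at hmem
  exact (mem_kerPowRange_iff.1 hmem).2

theorem dis_eq_of_stableIterationSet_eq_Ici {T : X →L[ℂ] X} {d : ℕ}
    (h : stableIterationSet T = Set.Ici d) : dis T = d := by
  unfold dis
  rw [h]
  exact le_antisymm (iInf₂_le d (Set.mem_Ici.2 le_rfl))
    (le_iInf₂ fun m hm => by exact_mod_cast Set.mem_Ici.1 hm)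

theorem IsNilpotentOfDegree.pow_eq_zero_iff {S : X →L[ℂ] X} {d n : ℕ}
    (h : IsNilpotentOfDegree S d) : S ^ n = 0 ↔ d ≤ n := by
  obtain ⟨hS, rfl⟩ := h
  exact ⟨fun hn => Nat.sInf_le hn,
    fun hn => pow_eq_zero_of_le hn (pow_nilpotencyClass hS)⟩

theorem IsReducedBy.mem_left_of_mem_powRange {T : X →L[ℂ] X} {M N : Submodule ℂ X}
    (h : IsReducedBy T M N) {n : ℕ} (hn : (T.restrict h.invariant_right) ^ n = 0) {x : X}
    (hx : x ∈ powRange T n) : x ∈ M := by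
  obtain ⟨y, rfl⟩ := mem_powRange_iff.1 hx
  obtain ⟨a, ha, b, hb, rfl⟩ :=
    Submodule.mem_sup.1 (h.isCompl.sup_eq_top ▸ Submodule.mem_top (x := y))
  have ha' := coe_restrict_pow_apply T h.invariant_left n ⟨a, ha⟩
  have hb' := coe_restrict_pow_apply T h.invariant_right n ⟨b, hb⟩
  rw [hn] at hb'
  rw [map_add, ← hb', ← ha']
  simp

theorem IsKatoTypeOfDegree.stableIterationSet_eq_Ici {T : X →L[ℂ] X} {d : ℕ}
    (hT : IsKatoTypeOfDegree T d) : stableIterationSet T = Set.Ici d := by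
  obtain ⟨M, N, h, ⟨-, hM⟩, hN⟩ := hT
  ext m
  rw [Set.mem_Ici]
  constructor
  · intro hm
    by_contra! hlt
    -- Here `m < d` makes `d - 1` a true predecessor.
    have hne : (T.restrict h.invariant_right) ^ (d - 1) ≠ 0 := by
      rw [Ne, hN.pow_eq_zero_iff]
      omega
    refine hne (ContinuousLinearMap.ext fun y => Subtype.ext ?_)
    have hmem : ((T.restrict h.invariant_right ^ (d - 1)) y : X) ∈ kerPowRange T (d - 1) := by
      refine mem_kerPowRange_iff.2 ⟨?_, y, (coe_restrict_pow_apply T _ _ y).symm⟩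
      have h0 : (T.restrict h.invariant_right ^ d) y = 0 := by
        rw [hN.pow_eq_zero_iff.2 le_rfl]
        rfl
      rw [← Nat.sub_add_cancel (show 1 ≤ d by omega), pow_succ'] at h0
      exact congrArg Subtype.val h0
    -- Stability from `m` on pushes this vector of N into R(T^d) ⊆ M, so it vanishes.
    have hmem' := kerPowRange_antitone T (show m ≤ d - 1 by omega) hmem
    rw [hm d hlt.le] at hmem'
    exact Submodule.disjoint_def.1 h.isCompl.disjoint _
      (h.mem_left_of_mem_powRange (hN.pow_eq_zero_iff.2 le_rfl) (mem_kerPowRange_iff.1 hmem').2)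
      (Subtype.mem _)
  · intro hm r hr
    refine le_antisymm (fun x hx => ?_) (kerPowRange_antitone T hr)
    obtain ⟨h0, hx⟩ := mem_kerPowRange_iff.1 hx
    have hxM := h.mem_left_of_mem_powRange (hN.pow_eq_zero_iff.2 hm) hx
    -- Semi-regularity of T_M yields a preimage under T_M^r for every `r`.
    obtain ⟨y, hy⟩ := mem_powRange_iff.1
      (ker_le_powRange_of_dis_eq_zero hM (x := ⟨x, hxM⟩) (Subtype.ext h0) r)
    refine mem_kerPowRange_iff.2 ⟨h0, y, ?_⟩
    exact (coe_restrict_pow_apply T h.invariant_left r y).symm.trans (congrArg Subtype.val hy)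

theorem IsKatoTypeOfDegree.dis_eq {T : X →L[ℂ] X} {d : ℕ} (hT : IsKatoTypeOfDegree T d) :
    dis T = d :=
  dis_eq_of_stableIterationSet_eq_Ici hT.stableIterationSet_eq_Ici

end KatoTypeDegree

theorem mainTheorem4 {X : Type*} [NormedAddCommGroup X] [NormedSpace ℂ X] [CompleteSpace X]
    (T : X →L[ℂ] X) (hT : IsKatoType T) (d : ℕ) :
    IsKatoTypeOfDegree T d ↔ dis T = (d : ℕ∞) := by
  refine ⟨IsKatoTypeOfDegree.dis_eq, fun hd => ?_⟩
  obtain ⟨e, he⟩ := hT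
  obtain rfl : e = d := by exact_mod_cast he.dis_eq.symm.trans hd
  exact he
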